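/- All operators are bounded operators on complex Hilbert spaces. For a Hilbert space $E$ let $H^2(E)$ be the Hilbert space of $E$-valued power series $f(z)=\sum_{n\ge 0}a_nz^n$ on the open unit disc with $\|f\|^2=\sum_n\|a_n\|^2<\infty$; for an operator-valued function $\Theta$ on the disc that multiplies $H^2(E)$ boundedly into itself let $M_\Theta$ be the operator $(M_\Theta f)(z)=\Theta(z)f(z)$ on $H^2(E)$. A contraction $T$ is pure if $T^{*n}\to 0$ strongly as $n\to\infty$. Let $T$ be a pure contraction on a Hilbert space $\mathcal H$ and let $T_1,T_2\in\mathcal B(\mathcal H)$. Then $T_1,T_2$ are commuting contractions with $T=T_1T_2$ if and only if there exist a Hilbert space $E$, an orthogonal projection $P$ and a unitary $U$ in $\mathcal B(E)$, a closed subspace $\mathcal Q\subseteq H^2(E)$ and a unitary $W:\mathcal H\to\mathcal Q$ (by which $\mathcal H$ is regarded as a subspace of $H^2(E)$) such that, with $P^\perp=I-P$, $\Phi(z)=(P+zP^\perp)U^*$ and $\Psi(z)=U(P^\perp+zP)$, the subspace $\mathcal Q$ is invariant under $M_\Phi^*$ and $M_\Psi^*$ and the following hold, where $P_{\mathcal Q}$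 is the orthogonal projection of $H^2(E)$ onto $\mathcal Q$: (i) $P_{\mathcal Q}M_{\Phi\Psi}|_{\mathcal Q}=P_{\mathcal Q}M_{\Psi\Phi}|_{\mathcal Q}=P_{\mathcal Q}M_z|_{\mathcal Q}$, and $WTW^*=P_{\mathcal Q}M_z|_{\mathcal Q}$; (ii) $WT_1W^*=P_{\mathcal Q}M_\Phi|_{\mathcal Q}$ and $WT_2W^*=P_{\mathcal Q}M_\Psi|_{\mathcal Q}$. -/

import Mathlib

open Filter Topology ContinuousLinearMap

universe u

/-- A contraction `T` is pure (of class `C.₀`) if `T*ⁿ → 0` strongly. -/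
structure IsPureContraction {H : Type*} [NormedAddCommGroup H] [InnerProductSpace ℂ H]
    [CompleteSpace H] (T : H →L[ℂ] H) : Prop where
  norm_le_one : ‖T‖ ≤ 1
  tendsto_zero : ∀ h : H, Tendsto (fun n : ℕ => (adjoint T ^ n) h) atTop (𝓝 0)

/-- The Hardy space `H²(E)` of `E`-valued power series `∑ aₙ zⁿ` on the unit disc with
`∑ ‖aₙ‖² < ∞`, normed by `‖f‖² = ∑ ‖aₙ‖²`. An element is stored as its sequence of Taylor
coefficients; the function on the disc is `HardySpace.eval`. -/
abbrev HardySpace (E : Type*) [NormedAddCommGroup E] : Type _ := lp (fun _ : ℕ => E) 2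

namespace HardySpace

section

variable {E : Type*} [NormedAddCommGroup E] [InnerProductSpace ℂ E]

/-- The value `f(z) = ∑ aₙ zⁿ` at a point of the open unit disc. -/
noncomputable def eval (f : HardySpace E) (z : ℂ) : E := ∑' n : ℕ, z ^ n • f n

/-- `M` is the operator of multiplication by `Θ`: `(M f)(z) = Θ(z) f(z)` on the unit disc. -/
def IsMultiplication (Θ : ℂ → E →L[ℂ] E) (M : HardySpace E →L[ℂ] HardySpace E) : Prop :=
  ∀ (f : HardySpace E) (z : ℂ), ‖z‖ < 1 → eval (M f) z = Θ z (eval f z)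

open Classical in
/-- The multiplication operator `M_Θ` on `H²(E)`, for a multiplier `Θ` of `H²(E)`
(and `0` if `Θ` is not a multiplier). It is unique by `isMultiplication_unique`. -/
noncomputable def mulOp (Θ : ℂ → E →L[ℂ] E) : HardySpace E →L[ℂ] HardySpace E :=
  if h : ∃ M, IsMultiplication Θ M then h.choose else 0

theorem summable_eval [CompleteSpace E] (f : HardySpace E) {z : ℂ} (hz : ‖z‖ < 1) :
    Summable fun n : ℕ => z ^ n • f n := by
  refine Summable.of_norm_bounded (g := fun n : ℕ => ‖z‖ ^ n * ‖f‖)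
    ((summable_geometric_of_lt_one (norm_nonneg z) hz).mul_right _) fun n => ?_
  rw [norm_smul, norm_pow]
  exact mul_le_mul_of_nonneg_left (lp.norm_apply_le_norm (by norm_num) f n) (by positivity)

/-- An element of `H²(E)` is determined by its values on the disc. -/
theorem eval_injective [CompleteSpace E] {f g : HardySpace E}
    (h : ∀ z : ℂ, ‖z‖ < 1 → eval f z = eval g z) : f = g := by
  have key : ∀ f : HardySpace E, HasFPowerSeriesOnBall (eval f)
      (fun n => ContinuousMultilinearMap.mkPiRing ℂ (Fin n) (f n)) 0 1 := by
    intro f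
    refine ⟨?_, by norm_num, ?_⟩
    · have := FormalMultilinearSeries.le_radius_of_bound
        (fun n => ContinuousMultilinearMap.mkPiRing ℂ (Fin n) (f n)) (r := 1) ‖f‖ (by
          intro n
          simpa using lp.norm_apply_le_norm (by norm_num) f n)
      simpa using this
    · intro y hy
      have hy' : ‖y‖ < 1 := by
        rw [Metric.mem_eball, edist_zero_right, enorm_eq_nnnorm] at hy
        exact_mod_cast hy
      simpa [eval] using (summable_eval f hy').hasSum
  have hf := (key f).hasFPowerSeriesAt
  have hg := (key g).hasFPowerSeriesAt
  have heq : eval f =ᶠ[𝓝 0] eval g := by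
    filter_upwards [Metric.ball_mem_nhds (0 : ℂ) one_pos] with z hz
    exact h z (by simpa using hz)
  have hp := (hf.congr heq).eq_formalMultilinearSeries hg
  ext n
  have := congrArg (fun p => p (fun _ => (1 : ℂ))) (congrFun hp n)
  simpa using this

theorem isMultiplication_unique [CompleteSpace E] {Θ : ℂ → E →L[ℂ] E}
    {M N : HardySpace E →L[ℂ] HardySpace E} (hM : IsMultiplication Θ M)
    (hN : IsMultiplication Θ N) : M = N :=
  ContinuousLinearMap.ext fun f => eval_injective fun z hz => by rw [hM f z hz, hN f z hz]

theorem mulOp_eq [CompleteSpace E] {Θ : ℂ → E →L[ℂ] E}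
    {M : HardySpace E →L[ℂ] HardySpace E} (hM : IsMultiplication Θ M) : mulOp Θ = M := by
  have h : ∃ M, IsMultiplication Θ M := ⟨M, hM⟩
  rw [mulOp, dif_pos h]
  exact isMultiplication_unique h.choose_spec hM

/-- The coefficientwise action of an operator on `E`, with symbol the constant function. -/
noncomputable def diag (A : E →L[ℂ] E) : HardySpace E →L[ℂ] HardySpace E :=
  LinearMap.mkContinuous
    { toFun := fun f => ⟨fun n => A (f n), ((lp.memℓp f).const_smul (‖A‖ : ℂ)).mono' (by
        intro n
        simpa [norm_smul] using A.le_opNorm (f n))⟩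
      map_add' := fun f g => by ext n; exact A.map_add (f n) (g n)
      map_smul' := fun c f => by ext n; simp }
    ‖A‖ (fun f => by
      have : ‖(‖A‖ : ℂ) • f‖ = ‖A‖ * ‖f‖ := by rw [norm_smul, Complex.norm_real, norm_norm]
      rw [← this]
      refine lp.norm_mono (by norm_num) fun n => ?_
      have h : ‖(‖A‖ : ℂ) • f n‖ = ‖A‖ * ‖f n‖ := by
        rw [norm_smul, Complex.norm_real, norm_norm]
      exact (A.le_opNorm (f n)).trans h.ge)

/-- The sequence `(0, a₀, a₁, …)`. -/
def shiftFun (f : ℕ → E) : ℕ → E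
  | 0 => 0
  | n + 1 => f n

/-- Multiplication by the coordinate function: `(a₀, a₁, …) ↦ (0, a₀, a₁, …)`. -/
noncomputable def shift : HardySpace E →L[ℂ] HardySpace E :=
  LinearMap.mkContinuous
    { toFun := fun f => ⟨shiftFun f, memℓp_gen ((summable_nat_add_iff 1).1 (by
        simpa [shiftFun] using (lp.memℓp f).summable (by norm_num)))⟩
      map_add' := fun f g => by
        ext n
        cases n with
        | zero => exact (add_zero (0 : E)).symm
        | succ n => rfl
      map_smul' := fun c f => by ext n; cases n <;> simp [shiftFun] }
    1 (fun f => by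
      rw [one_mul]
      have hs := (lp.memℓp f).summable (by norm_num : 0 < (2 : ENNReal).toReal)
      refine lp.norm_le_of_tsum_le (by norm_num) (norm_nonneg f) ?_
      rw [lp.norm_rpow_eq_tsum (by norm_num) f]
      refine le_of_eq ?_
      rw [Summable.tsum_eq_zero_add ((summable_nat_add_iff 1).1 (by simpa [shiftFun] using hs))]
      simp [shiftFun])

theorem isMultiplication_diag [CompleteSpace E] (A : E →L[ℂ] E) :
    IsMultiplication (fun _ => A) (diag A) := by
  intro f z hz
  simp only [eval]
  rw [A.map_tsum (summable_eval f hz)]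
  exact tsum_congr fun n => (A.map_smul (z ^ n) (f n)).symm

theorem isMultiplication_shift [CompleteSpace E] :
    IsMultiplication (fun z => z • (1 : E →L[ℂ] E)) (shift (E := E)) := by
  intro f z hz
  have h := summable_eval (shift f) hz
  have h' := summable_eval f hz
  calc eval (shift f) z = z ^ 0 • shift f 0 + ∑' n : ℕ, z ^ (n + 1) • shift f (n + 1) :=
        h.tsum_eq_zero_add
    _ = ∑' n : ℕ, z • (z ^ n • f n) := by
        have h0 : shift f 0 = 0 := rfl
        rw [h0, smul_zero, zero_add]
        refine tsum_congr fun n => ?_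
        rw [smul_smul, ← pow_succ']
        rfl
    _ = (z • (1 : E →L[ℂ] E)) (eval f z) := by
        rw [h'.tsum_const_smul]; rfl

theorem IsMultiplication.add [CompleteSpace E] {Θ Ξ : ℂ → E →L[ℂ] E}
    {M N : HardySpace E →L[ℂ] HardySpace E} (hM : IsMultiplication Θ M)
    (hN : IsMultiplication Ξ N) : IsMultiplication (fun z => Θ z + Ξ z) (M + N) := by
  intro f z hz
  have : eval ((M + N) f) z = eval (M f) z + eval (N f) z := by
    simp only [eval, ← (summable_eval (M f) hz).tsum_add (summable_eval (N f) hz), ← smul_add]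
    rfl
  rw [this, hM f z hz, hN f z hz]; rfl

theorem IsMultiplication.mul {Θ Ξ : ℂ → E →L[ℂ] E}
    {M N : HardySpace E →L[ℂ] HardySpace E} (hM : IsMultiplication Θ M)
    (hN : IsMultiplication Ξ N) : IsMultiplication (fun z => Θ z * Ξ z) (M * N) := by
  intro f z hz
  show eval (M (N f)) z = Θ z (Ξ z (eval f z))
  rw [hM _ z hz, hN f z hz]

/-- The symbol `Φ(z) = (P + z P^⊥) U*`. -/
noncomputable def symbolPhi [CompleteSpace E] (P U : E →L[ℂ] E) (z : ℂ) : E →L[ℂ] E :=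
  (P + z • (1 - P)) * adjoint U

/-- The symbol `Ψ(z) = U (P^⊥ + z P)`. -/
noncomputable def symbolPsi (P U : E →L[ℂ] E) (z : ℂ) : E →L[ℂ] E :=
  U * ((1 - P) + z • P)

/-- The symbol `z` (times the identity of `E`), so that `mulOp symbolZ` is `M_z`. -/
noncomputable def symbolZ (z : ℂ) : E →L[ℂ] E := z • (1 : E →L[ℂ] E)

/-- `z` is a multiplier of `H²(E)`. -/
theorem isMultiplication_symbolZ [CompleteSpace E] :
    IsMultiplication (symbolZ (E := E)) (mulOp symbolZ) := by
  have h : IsMultiplication (symbolZ (E := E)) shift := isMultiplication_shift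
  rwa [mulOp_eq h]

/-- `Φ` is a multiplier of `H²(E)`, so `mulOp` takes its intended value at it. -/
theorem isMultiplication_symbolPhi [CompleteSpace E] (P U : E →L[ℂ] E) :
    IsMultiplication (symbolPhi P U) (mulOp (symbolPhi P U)) := by
  have h : IsMultiplication (symbolPhi P U)
      ((diag P + shift * diag (1 - P)) * diag (adjoint U)) := by
    exact ((isMultiplication_diag P).add
      (isMultiplication_shift.mul (isMultiplication_diag (1 - P)))).mul
      (isMultiplication_diag (adjoint U))
  rwa [mulOp_eq h]

/-- `Ψ` is a multiplier of `H²(E)`. -/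
theorem isMultiplication_symbolPsi [CompleteSpace E] (P U : E →L[ℂ] E) :
    IsMultiplication (symbolPsi P U) (mulOp (symbolPsi P U)) := by
  have h : IsMultiplication (symbolPsi P U) (diag U * (diag (1 - P) + shift * diag P)) := by
    exact (isMultiplication_diag U).mul ((isMultiplication_diag (1 - P)).add
      (isMultiplication_shift.mul (isMultiplication_diag P)))
  rwa [mulOp_eq h]

end

end HardySpace

section

variable {K : Type*} [NormedAddCommGroup K] [InnerProductSpace ℂ K]

/-- The compression `P_Q A|_Q` of an operator `A` on `K` to a closed subspace `Q`. -/
noncomputable def compression (Q : Submodule ℂ K) [Q.HasOrthogonalProjection] (A : K →L[ℂ] K) :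
    Q →L[ℂ] Q :=
  Q.orthogonalProjectionOnto ∘L A ∘L Q.subtypeL

/-- The unitary `W` from `H` onto `K` transforms the operator `A` on `H` into `B` on `K`. -/
def IsUnitarilyEquivVia {H : Type*} [NormedAddCommGroup H] [InnerProductSpace ℂ H]
    (W : H ≃ₗᵢ[ℂ] K) (A : H →L[ℂ] H) (B : K →L[ℂ] K) : Prop :=
  ∀ h : H, W (A h) = B (W h)

end

open HardySpace

/-! For the forward direction, put `Sᵢ = Tᵢ*`, with defect operators `Dᵢ`. Since `S₁` and `S₂`
commute, `‖h‖² - ‖S₁S₂h‖²` telescopes in two ways, so the columns `A₀ = (D₁, D₂S₁)` and `B₀ = (D₁S₂,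
D₂)` have equal norms at every `h`. Hence `B₀h ↦ A₀h` is isometric; it extends to a partial
isometry, and its Halmos dilation is the unitary `U`. With `P` selecting the `D₂` coordinate, the
definitions of `A₀` and `B₀` say exactly that `h ↦ ∑ A T*ⁿh zⁿ` intertwines `Tᵢ*` with `M_Φ*` and
`M_Ψ*`, where `A` is `A₀` padded by zero. Purity makes this embedding isometric, and its range is
`Q`. For the converse, `Φ` and `Ψ` are inner, so their compressions are contractions; co-invariance
of `Q` makes compression multiplicative, and condition (i) then gives `T = T₁T₂ = T₂T₁`. -/

/-! ### Partial isometries from equality of norms -/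

section PartialIsometry

variable {H G : Type*} [NormedAddCommGroup H] [InnerProductSpace ℂ H]
  [NormedAddCommGroup G] [InnerProductSpace ℂ G] [CompleteSpace G]

/-- Two operators with the same absolute value differ by a partial isometry on the left. -/
theorem exists_partialIsometry_of_norm_eq (A B : H →L[ℂ] G) (hAB : ∀ x, ‖A x‖ = ‖B x‖) :
    ∃ V : G →L[ℂ] G, V * adjoint V * V = V ∧ (∀ x, V (B x) = A x) ∧
      ∀ x, adjoint V (V (B x)) = B x := by
  let M : Submodule ℂ G := (LinearMap.range (B : H →ₗ[ℂ] G)).topologicalClosure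
  have hmem : ∀ x, B x ∈ M := fun x =>
    Submodule.le_topologicalClosure _ (LinearMap.mem_range_self (B : H →ₗ[ℂ] G) x)
  have : CompleteSpace M := (Submodule.isClosed_topologicalClosure _).completeSpace_coe
  let e : H →ₗ[ℂ] M := (B : H →ₗ[ℂ] G).codRestrict M hmem
  have he : DenseRange e := by
    intro m
    have hm := m.2
    rw [← SetLike.mem_coe, Submodule.topologicalClosure_coe] at hm
    rwa [closure_subtype, ← Set.range_comp]
  let V₀ : M →L[ℂ] G := (A : H →ₗ[ℂ] G).extendOfNorm e
  have hV₀ : ∀ x, V₀ (e x) = A x := fun x =>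
    LinearMap.extendOfNorm_eq he ⟨1, fun x => by rw [one_mul]; exact (hAB x).le⟩ x
  have hiso : ∀ m : M, ‖V₀ m‖ = ‖m‖ := by
    intro m
    refine he.induction_on (p := fun m => ‖V₀ m‖ = ‖m‖) m ?_ ?_
    · exact isClosed_eq V₀.continuous.norm continuous_norm
    · intro x
      rw [hV₀, hAB]; rfl
  have hadj : ∀ m : M, adjoint V₀ (V₀ m) = m := by
    have := (norm_map_iff_adjoint_comp_self V₀).1 hiso
    intro m
    exact congrArg (fun f => f m) this
  -- Extending by zero on the orthogonal complement makes `V*V` the projection onto `M`, whence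
  -- `VV*V = V`.
  let V : G →L[ℂ] G := V₀ ∘L M.orthogonalProjectionOnto
  have hVV : ∀ x, adjoint V (V x) = M.orthogonalProjectionOnto x := by
    intro x
    simp only [V, adjoint_comp, comp_apply, hadj, Submodule.adjoint_orthogonalProjectionOnto]
    rfl
  have hB : ∀ x, M.orthogonalProjectionOnto (B x) = e x := fun x =>
    Submodule.orthogonalProjectionOnto_mem_subspace_eq_self (e x)
  refine ⟨V, ?_, fun x => ?_, fun x => ?_⟩
  · ext x
    show V (adjoint V (V x)) = V x
    rw [hVV]
    simp only [V, comp_apply, Submodule.orthogonalProjectionOnto_mem_subspace_eq_self]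
  · simp only [V, comp_apply, hB, hV₀]
  · rw [hVV, hB]; rfl

end PartialIsometry

/-! ### Operator matrices and the Halmos dilation -/

section Block

variable {H G : Type*} [NormedAddCommGroup H] [InnerProductSpace ℂ H]
  [NormedAddCommGroup G] [InnerProductSpace ℂ G]

/-- The operator `h ↦ (a h, b h)` into the Hilbert sum `G ⊕ G`. -/
noncomputable def colOp (a b : H →L[ℂ] G) : H →L[ℂ] WithLp 2 (G × G) :=
  (WithLp.prodContinuousLinearEquiv 2 ℂ G G).symm.toContinuousLinearMap ∘L a.prod b

/-- The operator matrix `!![a, b; c, d]` on the Hilbert sum `G ⊕ G`. -/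
noncomputable def blockOp (a b c d : G →L[ℂ] G) : WithLp 2 (G × G) →L[ℂ] WithLp 2 (G × G) :=
  colOp (a ∘L WithLp.fstL 2 ℂ G G + b ∘L WithLp.sndL 2 ℂ G G)
    (c ∘L WithLp.fstL 2 ℂ G G + d ∘L WithLp.sndL 2 ℂ G G)

theorem colOp_apply (a b : H →L[ℂ] G) (x : H) : colOp a b x = WithLp.toLp 2 (a x, b x) := rfl

theorem blockOp_apply (a b c d : G →L[ℂ] G) (x : WithLp 2 (G × G)) :
    blockOp a b c d x =
      WithLp.toLp 2 (a x.ofLp.1 + b x.ofLp.2, c x.ofLp.1 + d x.ofLp.2) := rfl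

theorem norm_colOp_sq (a b : H →L[ℂ] G) (x : H) :
    ‖colOp a b x‖ ^ 2 = ‖a x‖ ^ 2 + ‖b x‖ ^ 2 := by
  rw [colOp_apply, WithLp.prod_norm_sq_eq_of_L2]; rfl

theorem blockOp_mul (a b c d a' b' c' d' : G →L[ℂ] G) :
    blockOp a b c d * blockOp a' b' c' d' =
      blockOp (a * a' + b * c') (a * b' + b * d') (c * a' + d * c') (c * b' + d * d') := by
  refine ContinuousLinearMap.ext fun x => ?_
  show blockOp a b c d (blockOp a' b' c' d' x) = _
  simp only [blockOp_apply, map_add, add_apply, mul_apply_eq_comp]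
  congr 2 <;> abel

theorem blockOp_one : blockOp (1 : G →L[ℂ] G) 0 0 1 = 1 := by
  refine ContinuousLinearMap.ext fun x => ?_
  simp [blockOp_apply]
  rfl

theorem one_sub_blockOp (a : G →L[ℂ] G) : 1 - blockOp a 0 0 0 = blockOp (1 - a) 0 0 1 := by
  refine ContinuousLinearMap.ext fun x => WithLp.ofLp_injective 2 ?_
  ext <;> simp [blockOp_apply]

variable [CompleteSpace G]

theorem adjoint_blockOp (a b c d : G →L[ℂ] G) :
    adjoint (blockOp a b c d) =
      blockOp (adjoint a) (adjoint c) (adjoint b) (adjoint d) := by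
  symm
  rw [eq_adjoint_iff]
  intro x y
  simp only [blockOp_apply, WithLp.prod_inner_apply, inner_add_left, inner_add_right,
    adjoint_inner_left]
  ring

theorem isStarProjection_blockOp {p : G →L[ℂ] G} (hp : IsStarProjection p) :
    IsStarProjection (blockOp p 0 0 0) := by
  refine ⟨?_, ?_⟩
  · rw [IsIdempotentElem, blockOp_mul]
    simp [hp.isIdempotentElem.eq]
  · rw [isSelfAdjoint_iff, star_eq_adjoint, adjoint_blockOp, ← star_eq_adjoint,
      hp.isSelfAdjoint.star_eq]
    simp

/-- The Halmos dilation of a partial isometry. -/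
theorem exists_unitary_extending {V : G →L[ℂ] G} (hV : V * adjoint V * V = V) :
    ∃ U ∈ unitary (WithLp 2 (G × G) →L[ℂ] WithLp 2 (G × G)),
      ∀ x, adjoint V (V x) = x → U (WithLp.toLp 2 (x, 0)) = WithLp.toLp 2 (V x, 0) := by
  have hV' : adjoint V * V * adjoint V = adjoint V := by
    have := congrArg star hV
    simpa [star_mul, star_eq_adjoint, mul_assoc] using this
  set W := adjoint V with hW
  have hWV : adjoint W = V := adjoint_adjoint V
  have h1 : adjoint (1 - V * W) = 1 - V * W := by
    rw [← star_eq_adjoint, star_sub, star_mul, star_one, star_eq_adjoint, star_eq_adjoint, hWV]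
  have h2 : adjoint (1 - W * V) = 1 - W * V := by
    rw [← star_eq_adjoint, star_sub, star_mul, star_one, star_eq_adjoint, star_eq_adjoint, hWV]
  have h3 : adjoint (-W) = -V := by rw [map_neg, hWV]
  rw [mul_assoc] at hV hV'
  have e1 : V * (1 - W * V) = 0 := by rw [mul_sub, mul_one, hV, sub_self]
  have e2 : (1 - V * W) * V = 0 := by rw [sub_mul, one_mul, mul_assoc, hV, sub_self]
  have e3 : W * (1 - V * W) = 0 := by rw [mul_sub, mul_one, hV', sub_self]
  have e4 : (1 - W * V) * W = 0 := by rw [sub_mul, one_mul, mul_assoc, hV', sub_self]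
  have e5 : (1 - V * W) * (1 - V * W) = 1 - V * W := by
    rw [mul_sub, mul_one, ← mul_assoc, e2, zero_mul, sub_zero]
  have e6 : (1 - W * V) * (1 - W * V) = 1 - W * V := by
    rw [mul_sub, mul_one, ← mul_assoc, e4, zero_mul, sub_zero]
  -- For a partial isometry the Halmos defect entries are the projections `1 - VV*` and `1 - V*V`,
  -- so no square roots are needed. The lower-left one kills the initial space, where the dilation
  -- therefore acts as `V`.
  refine ⟨blockOp V (1 - V * W) (1 - W * V) (-W), ?_, fun x hx => ?_⟩
  · rw [Unitary.mem_iff, star_eq_adjoint, adjoint_blockOp, h1, h2, h3, blockOp_mul, blockOp_mul,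
      ← blockOp_one]
    simp only [← hW, e1, e2, e3, e4, e5, e6, neg_mul, mul_neg, neg_neg, neg_zero, add_zero]
    constructor <;> congr 1 <;> abel
  · simp [blockOp_apply, hx]

end Block

/-! ### Defect operators -/

section Defect

variable {H : Type*} [NormedAddCommGroup H] [InnerProductSpace ℂ H] [CompleteSpace H]

/-- A contraction has a defect operator. -/
theorem exists_defect {S : H →L[ℂ] H} (hS : ‖S‖ ≤ 1) :
    ∃ D : H →L[ℂ] H, ∀ h, ‖D h‖ ^ 2 = ‖h‖ ^ 2 - ‖S h‖ ^ 2 := by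
  have key : ∀ h, RCLike.re (inner ℂ ((1 - adjoint S * S) h) h) = ‖h‖ ^ 2 - ‖S h‖ ^ 2 := by
    intro h
    rw [sub_apply, inner_sub_left, mul_apply_eq_comp, adjoint_inner_left, one_apply_eq_self, map_sub,
      inner_self_eq_norm_sq, inner_self_eq_norm_sq]
  have hpos : 0 ≤ 1 - adjoint S * S := by
    rw [nonneg_iff_isPositive, isPositive_def]
    refine ⟨?_, fun h => ?_⟩
    · rw [← isSelfAdjoint_iff_isSymmetric]
      exact (IsSelfAdjoint.one _).sub (IsSelfAdjoint.star_mul_self S)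
    · rw [reApplyInnerSelf_apply, key, sub_nonneg]
      have : ‖S h‖ ≤ ‖h‖ := by simpa using S.le_of_opNorm_le hS h
      gcongr
  refine ⟨CFC.sqrt (1 - adjoint S * S), fun h => ?_⟩
  rw [← key]
  have hsa : adjoint (CFC.sqrt (1 - adjoint S * S)) = CFC.sqrt (1 - adjoint S * S) :=
    (CFC.sqrt_nonneg (1 - adjoint S * S)).isSelfAdjoint.star_eq
  have hsq := congrArg (fun f => RCLike.re (inner ℂ (f h) h)) (CFC.sqrt_mul_sqrt_self _ hpos)
  rw [← hsq]
  show _ = RCLike.re (inner ℂ (CFC.sqrt (1 - adjoint S * S) (CFC.sqrt (1 - adjoint S * S) h)) h)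
  nth_rw 2 [← hsa]
  rw [adjoint_inner_left, inner_self_eq_norm_sq]

end Defect

/-! ### Compressions to subspaces -/

section Compression

variable {H K : Type*} [NormedAddCommGroup H] [InnerProductSpace ℂ H]
  [NormedAddCommGroup K] [InnerProductSpace ℂ K]

/-- Moving `M` to the other side of the inner product shows that `M (W x) - W (S x)` is orthogonal
to the range of `W`, so `W (S x)` is the projection of `M (W x)`. -/
theorem isUnitarilyEquivVia_compression_range [CompleteSpace H] [CompleteSpace K]
    (W : H →ₗᵢ[ℂ] K)
    [(LinearMap.range W.toLinearMap).HasOrthogonalProjection] (S : H →L[ℂ] H)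
    (M : K →L[ℂ] K) (h : ∀ x, adjoint M (W x) = W (adjoint S x)) :
    IsUnitarilyEquivVia W.equivRange S (compression (LinearMap.range W.toLinearMap) M) := by
  intro x
  apply Subtype.ext
  show W (S x) = (LinearMap.range W.toLinearMap).starProjection (M (W x))
  refine (Submodule.eq_starProjection_of_mem_of_inner_eq_zero (LinearMap.mem_range_self W.toLinearMap (S x)) ?_).symm
  rintro _ ⟨y, rfl⟩
  show inner ℂ (M (W x) - W (S x)) (W y) = 0
  rw [inner_sub_left, W.inner_map_map, ← adjoint_inner_right, h, W.inner_map_map,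
    adjoint_inner_right, sub_self]

/-- Invariance of `Q` under `M*` means that `M` maps the orthogonal complement of `Q` into itself,
so the component of `N x` off `Q` contributes nothing. -/
theorem compression_mul [CompleteSpace K] (Q : Submodule ℂ K) [Q.HasOrthogonalProjection] (M N : K →L[ℂ] K)
    (h : ∀ f ∈ Q, adjoint M f ∈ Q) :
    compression Q (M * N) = compression Q M * compression Q N := by
  ext x
  show Q.starProjection (M (N x)) = Q.starProjection (M (Q.starProjection (N x)))
  rw [← sub_eq_zero, ← map_sub, ← map_sub, Submodule.starProjection_apply_eq_zero_iff,
    Submodule.mem_orthogonal]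
  intro u hu
  rw [← adjoint_inner_left]
  exact Submodule.sub_starProjection_mem_orthogonal _ _ (h u hu)

theorem norm_compression_le (Q : Submodule ℂ K) [Q.HasOrthogonalProjection] {M : K →L[ℂ] K}
    (hM : ‖M‖ ≤ 1) : ‖compression Q M‖ ≤ 1 := by
  refine opNorm_le_bound _ zero_le_one fun x => ?_
  calc ‖Q.orthogonalProjectionOnto (M x)‖ ≤ ‖M x‖ :=
        Q.norm_orthogonalProjectionOnto_apply_le _
    _ ≤ 1 * ‖x‖ := M.le_of_opNorm_le hM x

theorem IsUnitarilyEquivVia.norm_le {W : H ≃ₗᵢ[ℂ] K} {A : H →L[ℂ] H} {B : K →L[ℂ] K}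
    (h : IsUnitarilyEquivVia W A B) (hB : ‖B‖ ≤ 1) : ‖A‖ ≤ 1 := by
  refine opNorm_le_bound _ zero_le_one fun x => ?_
  rw [← W.norm_map, h, ← W.norm_map x]
  exact B.le_of_opNorm_le hB _

end Compression

/-! ### Multiplication operators and the embedding into the Hardy space -/

section Hardy

variable {E : Type*} [NormedAddCommGroup E] [InnerProductSpace ℂ E]

namespace HardySpace

theorem diag_mul (A B : E →L[ℂ] E) : diag (A * B) = diag A * diag B := rfl

theorem diag_add (A B : E →L[ℂ] E) : diag (A + B) = diag A + diag B := rfl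

theorem diag_one : diag (1 : E →L[ℂ] E) = 1 := rfl

theorem diag_zero : diag (0 : E →L[ℂ] E) = 0 := rfl

theorem diag_mul_shift (A : E →L[ℂ] E) : diag A * shift = shift * diag A := by
  refine ContinuousLinearMap.ext fun f => lp.ext (funext fun n => ?_)
  cases n with
  | zero => exact A.map_zero
  | succ n => rfl

variable [CompleteSpace E]

theorem adjoint_diag (A : E →L[ℂ] E) : adjoint (diag A) = diag (adjoint A) := by
  symm
  rw [eq_adjoint_iff]
  intro f g
  rw [lp.inner_eq_tsum, lp.inner_eq_tsum]
  exact tsum_congr fun n => adjoint_inner_left A (g n) (f n)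

theorem adjoint_shift_apply (f : HardySpace E) (n : ℕ) : adjoint shift f n = f (n + 1) := by
  -- Pairing with a sequence supported at `n` reads off the coefficient, and the shift moves that
  -- support to `n + 1`.
  refine ext_inner_left ℂ fun x => ?_
  rw [← lp.inner_single_left n x (adjoint shift f), adjoint_inner_right,
    ← lp.inner_single_left (n + 1) x f]
  congr 1
  refine lp.ext (funext fun k => ?_)
  cases k with
  | zero => simp [shift, shiftFun]
  | succ k =>
    show lp.single (E := fun _ : ℕ => E) 2 n x k = _
    simp [Pi.single_apply]

theorem adjoint_shift_mul_shift : adjoint (shift (E := E)) * shift = 1 := by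
  refine ContinuousLinearMap.ext fun f => lp.ext (funext fun n => ?_)
  exact adjoint_shift_apply (shift f) n

theorem mulOp_symbolPhi (P U : E →L[ℂ] E) :
    mulOp (symbolPhi P U) = (diag P + shift * diag (1 - P)) * diag (adjoint U) :=
  mulOp_eq (((isMultiplication_diag P).add
    (isMultiplication_shift.mul (isMultiplication_diag (1 - P)))).mul
      (isMultiplication_diag (adjoint U)))

theorem mulOp_symbolPsi (P U : E →L[ℂ] E) :
    mulOp (symbolPsi P U) = diag U * (diag (1 - P) + shift * diag P) :=
  mulOp_eq ((isMultiplication_diag U).mul ((isMultiplication_diag (1 - P)).add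
    (isMultiplication_shift.mul (isMultiplication_diag P))))

theorem mulOp_mul {Θ Ξ : ℂ → E →L[ℂ] E} {M N : HardySpace E →L[ℂ] HardySpace E}
    (hM : IsMultiplication Θ M) (hN : IsMultiplication Ξ N) : mulOp (Θ * Ξ) = M * N :=
  mulOp_eq (hM.mul hN)

theorem norm_le_one_of_adjoint_mul_self {K : Type*} [NormedAddCommGroup K]
    [InnerProductSpace ℂ K] [CompleteSpace K] {M : K →L[ℂ] K} (h : adjoint M * M = 1) :
    ‖M‖ ≤ 1 :=
  opNorm_le_bound _ zero_le_one fun x =>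
    ((norm_map_iff_adjoint_comp_self M).2 h x).trans_le (one_mul _).ge

section Symbols

variable {P U : E →L[ℂ] E}

theorem adjoint_mulOp_symbolPhi (hP : IsStarProjection P) :
    adjoint (mulOp (symbolPhi P U)) = diag U * (diag P + diag (1 - P) * adjoint shift) := by
  have h1 : adjoint P = P := hP.isSelfAdjoint.star_eq
  have h2 : adjoint (1 - P) = 1 - P := hP.one_sub.isSelfAdjoint.star_eq
  rw [mulOp_symbolPhi, ← star_eq_adjoint, star_mul, star_add, star_mul]
  simp only [star_eq_adjoint, adjoint_diag, h1, h2, adjoint_adjoint]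

theorem adjoint_mulOp_symbolPsi (hP : IsStarProjection P) :
    adjoint (mulOp (symbolPsi P U)) =
      (diag (1 - P) + diag P * adjoint shift) * diag (adjoint U) := by
  have h1 : adjoint P = P := hP.isSelfAdjoint.star_eq
  have h2 : adjoint (1 - P) = 1 - P := hP.one_sub.isSelfAdjoint.star_eq
  rw [mulOp_symbolPsi, ← star_eq_adjoint, star_mul, star_add, star_mul]
  simp only [star_eq_adjoint, adjoint_diag, h1, h2]

/-- Here `s` stands for the shift and `t` for its adjoint. Only `ts = 1` is required, as the shift
is not invertible in general; the cross terms vanish because `p` and `q` are orthogonal. -/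
theorem pencil_mul_pencil {R : Type*} [Ring R] {p q s t : R} (hp : p * p = p) (hq : q * q = q)
    (hpq : p * q = 0) (hqp : q * p = 0) (ht : t * p = p * t) (hs : p * s = s * p)
    (hts : t * s = 1) (h1 : p + q = 1) : (p + q * t) * (p + s * q) = 1 := by
  calc (p + q * t) * (p + s * q) = p * p + (p * s) * q + q * (t * p) + q * (t * s) * q := by
        simp only [add_mul, mul_add, mul_assoc, add_assoc, add_left_comm]
    _ = p * p + s * (p * q) + (q * p) * t + q * q := by
        rw [hs, ht, hts, mul_one, mul_assoc s, mul_assoc q]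
    _ = 1 := by rw [hp, hq, hpq, hqp, mul_zero, zero_mul, add_zero, add_zero, h1]

/-- The linear pencil of a projection is an inner function. -/
theorem adjoint_mul_self_pencil (hP : IsStarProjection P) :
    (diag P + diag (1 - P) * adjoint shift) * (diag P + shift * diag (1 - P)) = 1 := by
  have hPP := hP.isIdempotentElem.eq
  have hQQ := hP.one_sub.isIdempotentElem.eq
  have h0 : P * (1 - P) = 0 := by rw [mul_sub, mul_one, hPP, sub_self]
  have hs : adjoint shift * diag P = diag P * adjoint (shift (E := E)) := by
    have := congrArg star (diag_mul_shift P)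
    simpa only [star_mul, star_eq_adjoint, adjoint_diag, hP.isSelfAdjoint.star_eq,
      show adjoint P = P from hP.isSelfAdjoint.star_eq] using this
  have h0' : (1 - P) * P = 0 := by rw [sub_mul, one_mul, hPP, sub_self]
  refine pencil_mul_pencil ?_ ?_ ?_ ?_ hs (diag_mul_shift P) adjoint_shift_mul_shift ?_ <;>
    simp only [← diag_mul, ← diag_add, ← diag_zero, ← diag_one, hPP, hQQ, h0, h0',
      add_sub_cancel]

theorem norm_mulOp_symbolPhi_le (hP : IsStarProjection P) (hU : U ∈ unitary (E →L[ℂ] E)) :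
    ‖mulOp (symbolPhi P U)‖ ≤ 1 := by
  refine norm_le_one_of_adjoint_mul_self ?_
  rw [adjoint_mulOp_symbolPhi hP, mulOp_symbolPhi, mul_assoc, ← mul_assoc _ _ (diag (adjoint U)),
    adjoint_mul_self_pencil hP, one_mul, ← diag_mul, ← star_eq_adjoint,
    Unitary.mul_star_self_of_mem hU, diag_one]

theorem norm_mulOp_symbolPsi_le (hP : IsStarProjection P) (hU : U ∈ unitary (E →L[ℂ] E)) :
    ‖mulOp (symbolPsi P U)‖ ≤ 1 := by
  refine norm_le_one_of_adjoint_mul_self ?_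
  -- `Ψ` is the pencil with `P` and `1 - P` exchanged.
  have h := adjoint_mul_self_pencil hP.one_sub
  rw [sub_sub_cancel] at h
  rw [adjoint_mulOp_symbolPsi hP, mulOp_symbolPsi, mul_assoc, ← mul_assoc _ (diag U),
    ← diag_mul, ← star_eq_adjoint U, Unitary.star_mul_self_of_mem hU, diag_one, one_mul, h]

theorem symbolPhi_mul_symbolPsi (hP : IsStarProjection P) (hU : U ∈ unitary (E →L[ℂ] E)) :
    symbolPhi P U * symbolPsi P U = symbolZ := by
  have hPP := hP.isIdempotentElem.eq
  funext z
  show (P + z • (1 - P)) * star U * (U * ((1 - P) + z • P)) = z • 1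
  rw [mul_assoc, ← mul_assoc (star U), Unitary.star_mul_self_of_mem hU, one_mul]
  simp only [add_mul, mul_add, mul_sub, sub_mul, smul_mul_assoc, mul_smul_comm, hPP, mul_one,
    one_mul, smul_sub, sub_self]
  module

theorem symbolPsi_mul_symbolPhi (hP : IsStarProjection P) (hU : U ∈ unitary (E →L[ℂ] E)) :
    symbolPsi P U * symbolPhi P U = symbolZ := by
  have hPP := hP.isIdempotentElem.eq
  funext z
  show U * ((1 - P) + z • P) * ((P + z • (1 - P)) * star U) = z • 1
  have : ((1 - P) + z • P) * (P + z • (1 - P)) = z • 1 := by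
    simp only [add_mul, mul_add, mul_sub, sub_mul, smul_mul_assoc, mul_smul_comm, hPP, mul_one,
      one_mul, smul_sub, sub_self]
    module
  rw [mul_assoc, ← mul_assoc _ _ (star U), this, smul_mul_assoc, one_mul, mul_smul_comm,
    Unitary.mul_star_self_of_mem hU]

end Symbols

end HardySpace

/-- The canonical isometric embedding `h ↦ ∑ A Sⁿ h zⁿ` into the Hardy space, where `A` is a
defect operator of `S` and `Sⁿ → 0` strongly. -/
theorem exists_hardy_embedding {H : Type*} [NormedAddCommGroup H] [InnerProductSpace ℂ H]
    (A : H →L[ℂ] E) (S : H →L[ℂ] H) (hA : ∀ h, ‖A h‖ ^ 2 = ‖h‖ ^ 2 - ‖S h‖ ^ 2)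
    (hS : ∀ h, Tendsto (fun n : ℕ => (S ^ n) h) atTop (𝓝 0)) :
    ∃ W : H →ₗᵢ[ℂ] HardySpace E, ∀ h n, W h n = A ((S ^ n) h) := by
  have hsum : ∀ h, HasSum (fun n : ℕ => ‖A ((S ^ n) h)‖ ^ 2) (‖h‖ ^ 2) := by
    intro h
    rw [hasSum_iff_tendsto_nat_of_nonneg fun n => sq_nonneg _]
    -- The defect identity telescopes along the orbit, and strong convergence of `Sⁿ` to zero
    -- removes the remainder.
    have htel : ∀ n, ∑ i ∈ Finset.range n, ‖A ((S ^ i) h)‖ ^ 2 = ‖h‖ ^ 2 - ‖(S ^ n) h‖ ^ 2 := by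
      intro n
      induction n with
      | zero => simp
      | succ n ih =>
        have hn : (S ^ (n + 1)) h = S ((S ^ n) h) := by rw [pow_succ']; rfl
        rw [Finset.sum_range_succ, ih, hA, hn]
        ring
    simp only [htel]
    simpa using ((hS h).norm.pow 2).const_sub (‖h‖ ^ 2)
  have hmem : ∀ h, Memℓp (fun n : ℕ => A ((S ^ n) h)) 2 := fun h =>
    memℓp_gen (by simpa using (hsum h).summable)
  refine ⟨⟨⟨⟨fun h => ⟨fun n => A ((S ^ n) h), hmem h⟩, ?_⟩, ?_⟩, ?_⟩, fun h n => rfl⟩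
  · intro x y
    refine lp.ext (funext fun n => ?_)
    show A ((S ^ n) (x + y)) = A ((S ^ n) x) + A ((S ^ n) y)
    rw [map_add, map_add]
  · intro c x
    refine lp.ext (funext fun n => ?_)
    show A ((S ^ n) (c • x)) = c • A ((S ^ n) x)
    rw [map_smul, map_smul]
  · intro h
    have h2 := lp.norm_rpow_eq_tsum (p := 2) (by norm_num)
      (⟨fun n => A ((S ^ n) h), hmem h⟩ : HardySpace E)
    have h3 : ‖(⟨fun n => A ((S ^ n) h), hmem h⟩ : HardySpace E)‖ ^ 2 = ‖h‖ ^ 2 := by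
      rw [← (hsum h).tsum_eq]
      simpa using h2
    exact (sq_eq_sq₀ (norm_nonneg _) (norm_nonneg _)).1 h3

end Hardy

/-! ### The projection and the unitary of a commuting pair -/

/-- A factorization of a contraction into commuting contractions yields a projection, a unitary
and a defect operator that intertwine. -/
theorem exists_projection_unitary_defect {H : Type u} [NormedAddCommGroup H]
    [InnerProductSpace ℂ H] [CompleteSpace H] {S₁ S₂ : H →L[ℂ] H} (h₁ : ‖S₁‖ ≤ 1)
    (h₂ : ‖S₂‖ ≤ 1) (hc : S₁ * S₂ = S₂ * S₁) :
    ∃ (E : Type u) (_ : NormedAddCommGroup E) (_ : InnerProductSpace ℂ E) (_ : CompleteSpace E)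
      (P U : E →L[ℂ] E) (A : H →L[ℂ] E), IsStarProjection P ∧ U ∈ unitary (E →L[ℂ] E) ∧
      (∀ h, ‖A h‖ ^ 2 = ‖h‖ ^ 2 - ‖S₁ (S₂ h)‖ ^ 2) ∧
      (∀ h, U (P (A h) + (1 - P) (A (S₁ (S₂ h)))) = A (S₁ h)) ∧
      (∀ h, (1 - P) (adjoint U (A h)) + P (adjoint U (A (S₁ (S₂ h)))) = A (S₂ h)) := by
  obtain ⟨D₁, hD₁⟩ := exists_defect h₁
  obtain ⟨D₂, hD₂⟩ := exists_defect h₂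
  have hc' : ∀ h, S₁ (S₂ h) = S₂ (S₁ h) := fun h => congrArg (fun f => f h) hc
  -- The two ways of telescoping the defect of `S₁S₂`: through `S₁h` and through `S₂h`.
  let A₀ := colOp D₁ (D₂ * S₁)
  let B₀ := colOp (D₁ * S₂) D₂
  have hA₀ : ∀ h, ‖A₀ h‖ ^ 2 = ‖h‖ ^ 2 - ‖S₁ (S₂ h)‖ ^ 2 := by
    intro h
    rw [norm_colOp_sq, mul_apply_eq_comp, hD₁, hD₂, hc']; ring
  have hB₀ : ∀ h, ‖B₀ h‖ ^ 2 = ‖h‖ ^ 2 - ‖S₁ (S₂ h)‖ ^ 2 := by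
    intro h
    rw [norm_colOp_sq, mul_apply_eq_comp, hD₁, hD₂]; ring
  obtain ⟨V, hV, hVB, hVVB⟩ := exists_partialIsometry_of_norm_eq A₀ B₀ fun h =>
    (sq_eq_sq₀ (norm_nonneg _) (norm_nonneg _)).1 ((hA₀ h).trans (hB₀ h).symm)
  obtain ⟨U, hU, hUV⟩ := exists_unitary_extending hV
  let P₀ : WithLp 2 (H × H) →L[ℂ] WithLp 2 (H × H) := 1 - blockOp 1 0 0 0
  have hP₀ : IsStarProjection P₀ := (isStarProjection_blockOp (.one _)).one_sub
  have hP₀x : ∀ x y, P₀ (WithLp.toLp 2 (x, y)) = WithLp.toLp 2 (0, y) := by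
    intro x y
    simp [P₀, one_sub_blockOp, blockOp_apply]
  have hP₀y : ∀ x y, (1 - P₀) (WithLp.toLp 2 (x, y)) = WithLp.toLp 2 (x, 0) := by
    intro x y
    simp [P₀, blockOp_apply]
  have hUB : ∀ h, U (colOp B₀ 0 h) = colOp A₀ 0 h := by
    intro h
    have := hUV (B₀ h) (hVVB h)
    rwa [hVB] at this
  have hUA : ∀ h, adjoint U (colOp A₀ 0 h) = colOp B₀ 0 h := by
    intro h
    rw [← hUB, ← star_eq_adjoint, ← mul_apply_eq_comp, Unitary.star_mul_self_of_mem hU]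
    rfl
  -- The second copy of `H ⊕ H` is the room needed by the dilation; `P` and the columns vanish
  -- there.
  refine ⟨WithLp 2 (WithLp 2 (H × H) × WithLp 2 (H × H)), inferInstance, inferInstance,
    inferInstance, blockOp P₀ 0 0 0, U, colOp A₀ 0, isStarProjection_blockOp hP₀, hU,
    fun h => ?_, fun h => ?_, fun h => ?_⟩
  · rw [norm_colOp_sq, hA₀]; simp
  -- The argument of `U` is `(D₁S₁S₂h, D₂S₁h) = B₀(S₁h)`, padded by zero. In the last identity,
  -- likewise, `(D₁S₂h, D₂S₁S₂h) = A₀(S₂h)`.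
  · refine (congrArg U ?_).trans (hUB _)
    simp only [A₀, B₀, one_sub_blockOp, colOp_apply, blockOp_apply, hP₀x, hP₀y]
    simp [← WithLp.toLp_add, hc']
  · rw [hUA, hUA]
    simp only [A₀, B₀, one_sub_blockOp, colOp_apply, blockOp_apply, hP₀x, hP₀y]
    simp [← WithLp.toLp_add, hc']

/-! ### The characterization of factorizations -/

theorem theorem3 {H : Type u} [NormedAddCommGroup H] [InnerProductSpace ℂ H] [CompleteSpace H]
    (T : H →L[ℂ] H) (hT : IsPureContraction T) (T₁ T₂ : H →L[ℂ] H) :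
    (‖T₁‖ ≤ 1 ∧ ‖T₂‖ ≤ 1 ∧ T₁ * T₂ = T₂ * T₁ ∧ T = T₁ * T₂) ↔
    ∃ (E : Type u) (_ : NormedAddCommGroup E) (_ : InnerProductSpace ℂ E) (_ : CompleteSpace E)
      (P U : E →L[ℂ] E) (Q : Submodule ℂ (HardySpace E)) (_ : CompleteSpace Q) (W : H ≃ₗᵢ[ℂ] Q),
      IsStarProjection P ∧ U ∈ unitary (E →L[ℂ] E) ∧
      (∀ f ∈ Q, adjoint (mulOp (symbolPhi P U)) f ∈ Q) ∧
      (∀ f ∈ Q, adjoint (mulOp (symbolPsi P U)) f ∈ Q) ∧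
      compression Q (mulOp (symbolPhi P U * symbolPsi P U)) =
        compression Q (mulOp (symbolPsi P U * symbolPhi P U)) ∧
      compression Q (mulOp (symbolPsi P U * symbolPhi P U)) = compression Q (mulOp symbolZ) ∧
      IsUnitarilyEquivVia W T (compression Q (mulOp symbolZ)) ∧
      IsUnitarilyEquivVia W T₁ (compression Q (mulOp (symbolPhi P U))) ∧
      IsUnitarilyEquivVia W T₂ (compression Q (mulOp (symbolPsi P U))) := by
  constructor
  · rintro ⟨h₁, h₂, hc, hTT⟩
    have hadj : adjoint T = adjoint T₁ * adjoint T₂ := by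
      rw [hTT, hc]; exact adjoint_comp T₂ T₁
    have hc' : adjoint T₁ * adjoint T₂ = adjoint T₂ * adjoint T₁ := by
      have := congrArg star hc
      rw [star_mul, star_mul] at this
      exact this.symm
    obtain ⟨E, i₁, i₂, i₃, P, U, A, hP, hU, hA, hAΦ, hAΨ⟩ := exists_projection_unitary_defect
      ((LinearIsometryEquiv.norm_map adjoint T₁).trans_le h₁)
      ((LinearIsometryEquiv.norm_map adjoint T₂).trans_le h₂) hc'
    have hS : ∀ h, adjoint T h = adjoint T₁ (adjoint T₂ h) := fun h =>
      congrArg (fun f => f h) hadj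
    simp only [← hS] at hA hAΦ hAΨ
    obtain ⟨W, hW⟩ := exists_hardy_embedding A (adjoint T) hA hT.tendsto_zero
    have hcomm₁ : Commute (adjoint T) (adjoint T₁) := by
      rw [hadj, Commute, SemiconjBy, mul_assoc, ← hc']
    have hcomm₂ : Commute (adjoint T) (adjoint T₂) := by
      rw [hadj, hc', Commute, SemiconjBy, mul_assoc, hc']
    have hpow₁ : ∀ n h, (adjoint T ^ n) (adjoint T₁ h) = adjoint T₁ ((adjoint T ^ n) h) :=
      fun n h => congrArg (fun f => f h) (hcomm₁.pow_left n).eq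
    have hpow₂ : ∀ n h, (adjoint T ^ n) (adjoint T₂ h) = adjoint T₂ ((adjoint T ^ n) h) :=
      fun n h => congrArg (fun f => f h) (hcomm₂.pow_left n).eq
    have hsucc : ∀ n h, (adjoint T ^ (n + 1)) h = adjoint T ((adjoint T ^ n) h) := fun n h => by
      rw [pow_succ']; rfl
    have hZ : ∀ h, adjoint (mulOp symbolZ) (W h) = W (adjoint T h) := by
      intro h
      rw [mulOp_eq (Θ := symbolZ (E := E)) isMultiplication_shift]
      refine lp.ext (funext fun n => ?_)
      rw [adjoint_shift_apply, hW, hW, pow_succ]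
      rfl
    -- The `n`-th coefficients agree by the defect relation `hAΦ` at the vector `T*ⁿh`, since `T₁*`
    -- commutes with `T*`.
    have hΦ : ∀ h, adjoint (mulOp (symbolPhi P U)) (W h) = W (adjoint T₁ h) := by
      intro h
      rw [adjoint_mulOp_symbolPhi hP]
      refine lp.ext (funext fun n => ?_)
      show U (P (W h n) + (1 - P) (adjoint shift (W h) n)) = _
      rw [adjoint_shift_apply, hW, hW, hW, hsucc, hAΦ, hpow₁]
    have hΨ : ∀ h, adjoint (mulOp (symbolPsi P U)) (W h) = W (adjoint T₂ h) := by
      intro h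
      rw [adjoint_mulOp_symbolPsi hP]
      refine lp.ext (funext fun n => ?_)
      show (1 - P) (adjoint U (W h n)) +
        P (adjoint shift (diag (adjoint U) (W h)) n) = _
      rw [adjoint_shift_apply]
      show (1 - P) (adjoint U (W h n)) + P (adjoint U (W h (n + 1))) = _
      rw [hW, hW, hW, hsucc, hAΨ, hpow₂]
    have hQ : CompleteSpace (LinearMap.range W.toLinearMap) :=
      (completeSpace_congr (e := W.equivRange.toEquiv)
        W.equivRange.isometry.isUniformEmbedding).1 inferInstance
    refine ⟨E, i₁, i₂, i₃, P, U, LinearMap.range W.toLinearMap, hQ, W.equivRange, hP, hU,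
      ?_, ?_, ?_, ?_, isUnitarilyEquivVia_compression_range W T _ hZ,
      isUnitarilyEquivVia_compression_range W T₁ _ hΦ,
      isUnitarilyEquivVia_compression_range W T₂ _ hΨ⟩
    · rintro _ ⟨h, rfl⟩
      exact ⟨adjoint T₁ h, (hΦ h).symm⟩
    · rintro _ ⟨h, rfl⟩
      exact ⟨adjoint T₂ h, (hΨ h).symm⟩
    · rw [symbolPhi_mul_symbolPsi hP hU, symbolPsi_mul_symbolPhi hP hU]
    · rw [symbolPsi_mul_symbolPhi hP hU]
  · rintro ⟨E, _, _, _, P, U, Q, _, W, hP, hU, hQΦ, hQΨ, hcomp, hcompZ, hWT, hW₁, hW₂⟩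
    -- Invariance under `M_Φ*` splits the compression of `M_Φ M_Ψ`; for the reverse order,
    -- invariance under `M_Ψ*` is what counts.
    have key : ∀ h, T h = T₁ (T₂ h) := by
      intro h
      apply W.injective
      rw [hWT, hW₁, hW₂, ← hcompZ, ← hcomp, mulOp_mul (isMultiplication_symbolPhi P U)
        (isMultiplication_symbolPsi P U), compression_mul Q _ _ hQΦ]
      rfl
    have key' : ∀ h, T h = T₂ (T₁ h) := by
      intro h
      apply W.injective
      rw [hWT, hW₂, hW₁, ← hcompZ, mulOp_mul (isMultiplication_symbolPsi P U)
        (isMultiplication_symbolPhi P U), compression_mul Q _ _ hQΨ]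
      rfl
    refine ⟨hW₁.norm_le (norm_compression_le Q (norm_mulOp_symbolPhi_le hP hU)),
      hW₂.norm_le (norm_compression_le Q (norm_mulOp_symbolPsi_le hP hU)),
      ContinuousLinearMap.ext fun h => (key h).symm.trans (key' h),
      ContinuousLinearMap.ext key⟩
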